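/- Let $(\Omega,\mathcal F,P)$ be a probability space, let $1\le p<\infty$ and $p^{-1}+q^{-1}=1$, and write $\mathcal L_r=\mathcal L_r(\Omega,\mathcal F,P)$ (random variables that are equal almost surely are identified). Let $n\ge 2$ and $Z_1,\dots,Z_n\in\mathcal L_p$. For $i=1,\dots,n$ let $D_i$ be a convex subset of $\{Y\in\mathcal L_1: Y\ge 0,\ E[Y]=1\}$ that is closed in $\mathcal L_1$ and bounded in $\mathcal L_q$ (that is, $\sup_{Y\in D_i}\|Y\|_q<\infty$), and assume $\bigcap_{i=1}^n D_i\neq\emptyset$. Let $r_i(X)=\max\{E[XY]:Y\in D_i\}$ for $X\in\mathcal L_p$; this maximum is attained. Let $\mathcal G\subseteq\mathcal F$ be a sub-$\sigma$-field (for example a member $\mathcal F_m$ of a filtration). Consider the social problem $$\min\ \sum_{i=1}^n r_i(Z_i-W_i)\quad\text{s.t. } W_1,\dots,W_n\in\mathcal L_p(\mathcal G),\ \sum_{i=1}^n W_i=0, \tag{1}$$ whose objective equals $\max\{\sum_{i=1}^n E[(Z_i-W_i)Y_i]: Y_i\in D_i\ \forall i\}$, the value of the inner problem at $W$ (again an attained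 maximum). Consider also $$\max\ \sum_{i=1}^n E[Z_iY_i]\quad\text{s.t. } Y_i\in D_i\ \forall i\text{ and } E[Y_i\mid\mathcal G]\text{ is the same for all } i. \tag{2}$$ Then problem (2) has an optimum. Moreover, for every optimum $(W_1^*,\dots,W_n^*)$ of (1), every optimum $(Y_1,\dots,Y_n)$ of (2) is an optimum of the inner problem at $W^*$, $$\max\ \sum_{i=1}^n E[(Z_i-W_i^*)Y_i]\quad\text{s.t. } Y_i\in D_i\ \forall i .$$ In the complete-market case $\mathcal G=\mathcal F$, the optima of (2) are exactly the tuples $(Y_0,\dots,Y_0)$ where $Y_0$ is an optimum of $$\max\ E\Big[\Big(\sum_{i=1}^n Z_i\Big)Y_0\Big]\quad\text{s.t. } Y_0\in\bigcap_{i=1}^n D_i ,$$ and consequently, for every optimum $W^*$ of (1) with $\mathcal G=\mathcal F$, each such tuple is an optimum of the inner problem at $W^*$. -/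

import Mathlib

open MeasureTheory

open scoped ENNReal NNReal

namespace RiskMarket

noncomputable section

variable {Ω : Type*} {mΩ : MeasurableSpace Ω}

/-- The set `D₀` of probability densities with respect to `P`, as elements of `L₁(P)`. -/
def densities (P : Measure Ω) : Set (Lp ℝ 1 P) :=
  {Y | 0 ≤ Y ∧ ∫ ω, Y ω ∂P = 1}

/-- `D` is a risk set: a closed convex set of densities in `L₁(P)` that is bounded in `L_q`. -/
structure IsRiskSet (P : Measure Ω) (q : ℝ≥0∞) (D : Set (Lp ℝ 1 P)) : Prop where
  subset_densities : D ⊆ densities P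
  isClosed : IsClosed D
  convex : Convex ℝ D
  bounded : ∃ C : ℝ≥0, ∀ Y ∈ D, eLpNorm Y q P ≤ C

/-- The expectation `E[X Y]` of a risk `X ∈ L_p` under the price of risk `Y`. -/
def expect {P : Measure Ω} {p : ℝ≥0∞} (X : Lp ℝ p P) (Y : Lp ℝ 1 P) : ℝ :=
  ∫ ω, X ω * Y ω ∂P

/-- The coherent risk measure `r(X) = max {E[X Y] : Y ∈ D}` with risk set `D`. -/
def riskMeasure {P : Measure Ω} {p : ℝ≥0∞} (D : Set (Lp ℝ 1 P)) (X : Lp ℝ p P) : ℝ :=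
  sSup ((fun Y => expect X Y) '' D)

variable {P : Measure Ω} {p : ℝ≥0∞} {n : ℕ}

/-- Feasible trades in the market `𝓖`: each `W i` is in `L_p(𝓖)` (it has a
`𝓖`-measurable version), and the trades sum to zero. -/
def IsTrade (𝓖 : MeasurableSpace Ω) (W : Fin n → Lp ℝ p P) : Prop :=
  (∀ i, AEStronglyMeasurable[𝓖] (W i) P) ∧ ∑ i, W i = 0

/-- The total risk `∑ i, r_i(Z_i - W_i)` after the trades `W`. -/
def socialRisk (D : Fin n → Set (Lp ℝ 1 P)) (Z W : Fin n → Lp ℝ p P) : ℝ :=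
  ∑ i, riskMeasure (D i) (Z i - W i)

/-- `W` is optimal for the social (outer) problem: it minimizes the total risk among all trades
in the market `𝓖`. -/
def IsOptimalTrade (𝓖 : MeasurableSpace Ω) (D : Fin n → Set (Lp ℝ 1 P))
    (Z W : Fin n → Lp ℝ p P) : Prop :=
  IsTrade 𝓖 W ∧ ∀ W', IsTrade 𝓖 W' → socialRisk D Z W ≤ socialRisk D Z W'

/-- The objective `∑ i, E[X_i Y_i]`. -/
def totalExpect (X : Fin n → Lp ℝ p P) (Y : Fin n → Lp ℝ 1 P) : ℝ :=
  ∑ i, expect (X i) (Y i)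

/-- `Y` is an optimum of the inner problem at the trades `W`:
maximize `∑ i, E[(Z_i - W_i) Y_i]` over `Y_i ∈ D_i`. -/
def IsInnerOptimum (D : Fin n → Set (Lp ℝ 1 P)) (Z W : Fin n → Lp ℝ p P)
    (Y : Fin n → Lp ℝ 1 P) : Prop :=
  (∀ i, Y i ∈ D i) ∧
    ∀ Y' : Fin n → Lp ℝ 1 P, (∀ i, Y' i ∈ D i) → totalExpect (Z - W) Y' ≤ totalExpect (Z - W) Y

/-- Feasibility for the price problem: `Y_i ∈ D_i`, and `E[Y_i | 𝓖]` is the same for all `i`. -/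
def IsPriceFeasible (𝓖 : MeasurableSpace Ω) (D : Fin n → Set (Lp ℝ 1 P))
    (Y : Fin n → Lp ℝ 1 P) : Prop :=
  (∀ i, Y i ∈ D i) ∧ ∀ i j, P[Y i | 𝓖] =ᵐ[P] P[Y j | 𝓖]

/-- `Y` is an optimum of the price problem: maximize `∑ i, E[Z_i Y_i]` subject to `Y_i ∈ D_i` and
`E[Y_i | 𝓖]` being the same for all `i`. -/
def IsPriceOptimum (𝓖 : MeasurableSpace Ω) (D : Fin n → Set (Lp ℝ 1 P))
    (Z : Fin n → Lp ℝ p P) (Y : Fin n → Lp ℝ 1 P) : Prop :=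
  IsPriceFeasible 𝓖 D Y ∧
    ∀ Y', IsPriceFeasible 𝓖 D Y' → totalExpect Z Y' ≤ totalExpect Z Y

/-- `Y₀` is an optimum of the complete-market price problem: maximize `E[(∑ i, Z_i) Y₀]` over
`Y₀ ∈ ⋂ i, D_i`. -/
def IsCompletePriceOptimum (D : Fin n → Set (Lp ℝ 1 P)) (Z : Fin n → Lp ℝ p P)
    (Y₀ : Lp ℝ 1 P) : Prop :=
  Y₀ ∈ ⋂ i, D i ∧ ∀ Y ∈ ⋂ i, D i, expect (∑ i, Z i) Y ≤ expect (∑ i, Z i) Y₀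

end

end RiskMarket

namespace RiskMarket

open Filter Topology
open scoped Pointwise

/-! (1) and (2) are dual, and strong duality comes from Hahn-Banach rather than from compactness or
a minimax theorem. Let `v(V)` be the infimum over trades `W` of `∑ r_i(V_i - W_i)`. It is sublinear,
and finite because any common element of the `D_i` prices all trades at zero. Choose a linear `l ≤
v` with `l(Z) = v(Z)`. Comparing with `W = 0` gives `l(V) ≤ ∑ r_i(V_i)`, so `l` is represented by
some `Y_i ∈ D_i`; evaluating at a trade gives `l(W) ≤ 0`, which forces equal conditional
expectations. Hence a feasible `Y` attains the infimum of (1), and the claim on inner optima is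
complementary slackness.

The representation (`IsRiskSet.exists_mem_of_le_riskMeasure`) obtains a density by Radon-Nikodym and
places it in `D_i` by separation in `L_1`. It also yields attainment of the maximum defining `r_i`.
-/

/-- A functional dominated by a sublinear one, and equal to it at a given point. -/
theorem exists_linear_le_sublinear {E : Type*} [AddCommGroup E] [Module ℝ E] (N : E → ℝ)
    (N_hom : ∀ c : ℝ, 0 < c → ∀ x, N (c • x) = c * N x) (N_add : ∀ x y, N (x + y) ≤ N x + N y)
    (x : E) : ∃ g : E →ₗ[ℝ] ℝ, g x = N x ∧ ∀ y, g y ≤ N y := by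
  have N_0 : N 0 = 0 := by
    have := N_hom 2 (by norm_num) 0
    rw [smul_zero] at this
    linarith
  have key : ∀ c : ℝ, c • x = 0 → c • N x = 0 := by
    intro c hc
    rcases smul_eq_zero.1 hc with h | h
    · simp [h]
    · simp [h, N_0]
  obtain ⟨g, hg, hgN⟩ := exists_extension_of_le_sublinear
    (LinearPMap.mkSpanSingleton' x (N x) key) N N_hom N_add (by
      rintro ⟨y, hy⟩
      obtain ⟨c, rfl⟩ := Submodule.mem_span_singleton.1 hy
      rw [LinearPMap.mkSpanSingleton'_apply]
      -- For `c < 0` this gives `c * N x ≤ -c * N (-x) = N (c • x)`.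
      have hneg : -N (-x) ≤ N x := by
        have := N_add x (-x)
        rw [add_neg_cancel, N_0] at this
        linarith
      rcases lt_trichotomy c 0 with h | h | h
      · have h1 : c • x = (-c) • (-x) := by simp
        change c * N x ≤ N (c • x)
        rw [h1, N_hom (-c) (by linarith)]
        nlinarith
      · simp [h, N_0]
      · simp [N_hom c h])
  refine ⟨g, ?_, hgN⟩
  exact (hg ⟨x, Submodule.mem_span_singleton_self x⟩).trans
    (LinearPMap.mkSpanSingleton'_apply_self x (N x) key _)

/-! ### Densities of continuous functionals on `L_p`. -/

section Representation

variable {Ω : Type*} {mΩ : MeasurableSpace Ω} {P : Measure Ω} {p : ℝ≥0∞}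

theorem indicatorConstLp_biUnion_finset {ι : Type*} [IsFiniteMeasure P] {f : ι → Set Ω}
    (hf : ∀ i, MeasurableSet (f i)) (hd : Pairwise (Function.onFun Disjoint f)) (s : Finset ι) :
    indicatorConstLp p (s.measurableSet_biUnion fun i _ => hf i) (measure_ne_top P _) (1 : ℝ) =
      ∑ i ∈ s, indicatorConstLp p (hf i) (measure_ne_top P _) (1 : ℝ) := by
  classical
  induction s using Finset.induction_on with
  | empty => simp
  | insert a s ha ih =>
    have hdis : Disjoint (f a) (⋃ i ∈ s, f i) := by
      rw [Set.disjoint_iUnion₂_right]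
      intro i hi
      exact hd (by rintro rfl; exact ha hi)
    rw [Finset.sum_insert ha, ← ih, ← indicatorConstLp_disjoint_union _ _ _ _ hdis]
    congr 1
    simp

variable [Fact (1 ≤ p)]

/-- Indicators of disjoint sets sum in `L_p`, `p < ∞`, to the indicator of their union. -/
theorem hasSum_indicatorConstLp_iUnion [IsFiniteMeasure P] (hp : p ≠ ∞) {f : ℕ → Set Ω}
    (hf : ∀ i, MeasurableSet (f i)) (hd : Pairwise (Function.onFun Disjoint f)) :
    HasSum (fun i => indicatorConstLp p (hf i) (measure_ne_top P _) (1 : ℝ))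
      (indicatorConstLp p (MeasurableSet.iUnion hf) (measure_ne_top P _) (1 : ℝ)) := by
  unfold HasSum
  simp only [← indicatorConstLp_biUnion_finset hf hd]
  refine tendsto_indicatorConstLp_set hp ?_
  have h1 : ∀ s : Finset ℕ, P (symmDiff (⋃ i ∈ s, f i) (⋃ i, f i)) =
      P (⋃ i, f i) - ∑ i ∈ s, P (f i) := by
    intro s
    have hsub : (⋃ i ∈ s, f i) ⊆ ⋃ i, f i := Set.iUnion₂_subset fun i _ => Set.subset_iUnion f i
    rw [symmDiff_of_le hsub, measure_sdiff hsub
      (s.measurableSet_biUnion fun i _ => hf i).nullMeasurableSet (measure_ne_top _ _),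
      measure_biUnion_finset (fun i _ j _ hij => hd hij) fun i _ => hf i]
  simp only [h1]
  have h2 : HasSum (fun i => P (f i)) (P (⋃ i, f i)) := by
    rw [measure_iUnion hd hf]
    exact ENNReal.summable.hasSum
  have h3 := ENNReal.Tendsto.sub (tendsto_const_nhds (x := P (⋃ i, f i)) (f := atTop)) h2
    (Or.inl (measure_ne_top _ _))
  simpa using h3

/-- A continuous linear functional on `L_p`, `p < ∞`, has an integrable density on indicators. -/
theorem exists_density_indicator [IsFiniteMeasure P] (hp : p ≠ ∞) (φ : Lp ℝ p P →L[ℝ] ℝ) :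
    ∃ Y : Lp ℝ 1 P, ∀ (A : Set Ω) (hA : MeasurableSet A),
      φ (indicatorConstLp p hA (measure_ne_top P _) (1 : ℝ)) = ∫ ω in A, Y ω ∂P := by
  classical
  -- Countable additivity is continuity of `φ` along the `L_p`-convergent sum of indicators. The
  -- measure vanishes on `P`-null sets, so Radon-Nikodym supplies the density.
  let ν : SignedMeasure Ω :=
    { measureOf' := fun A => if hA : MeasurableSet A then
        φ (indicatorConstLp p hA (measure_ne_top P _) (1 : ℝ)) else 0
      empty' := by simp
      not_measurable' := fun A hA => by simp [hA]
      m_iUnion' := fun f hf hd => by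
        have := (hasSum_indicatorConstLp_iUnion (P := P) hp hf hd).map φ φ.continuous
        simpa [hf, MeasurableSet.iUnion hf, Function.comp_def] using this }
  have hν : ∀ (A : Set Ω) (hA : MeasurableSet A),
      ν A = φ (indicatorConstLp p hA (measure_ne_top P _) (1 : ℝ)) := fun A hA => dif_pos hA
  have hac : ν ≪ᵥ P.toENNRealVectorMeasure := by
    refine VectorMeasure.AbsolutelyContinuous.mk fun A hA h => ?_
    rw [Measure.toENNRealVectorMeasure_apply_measurable hA] at h
    have h0 : indicatorConstLp p hA (measure_ne_top P _) (1 : ℝ) = 0 := by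
      rw [Lp.eq_zero_iff_ae_eq_zero]
      filter_upwards [indicatorConstLp_coeFn (p := p) (hs := hA) (hμs := measure_ne_top P _)
        (c := (1 : ℝ)), measure_eq_zero_iff_ae_notMem.1 h] with ω h1 h2
      simp [h1, h2]
    rw [hν A hA, h0, map_zero]
  have hrn := (SignedMeasure.absolutelyContinuous_iff_withDensityᵥ_rnDeriv_eq ν P).1 hac
  have hint : Integrable (ν.rnDeriv P) P := SignedMeasure.integrable_rnDeriv ν P
  refine ⟨hint.toL1 _, fun A hA => ?_⟩
  rw [← hν A hA, ← congrArg (fun m => m A) hrn, withDensityᵥ_apply hint hA]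
  exact (setIntegral_congr_ae hA (by
    filter_upwards [hint.coeFn_toL1] with ω h _ using h)).symm

variable [IsFiniteMeasure P]

theorem apply_toLp_simpleFunc_eq_integral {φ : Lp ℝ p P →L[ℝ] ℝ} {Y : Ω → ℝ}
    (hY : Integrable Y P)
    (h : ∀ (A : Set Ω) (hA : MeasurableSet A),
      φ (indicatorConstLp p hA (measure_ne_top P _) (1 : ℝ)) = ∫ ω in A, Y ω ∂P)
    (f : SimpleFunc Ω ℝ) :
    φ ((f.memLp_of_isFiniteMeasure p P).toLp f) = ∫ ω, f ω * Y ω ∂P := by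
  have hint : ∀ f : SimpleFunc Ω ℝ, Integrable (fun ω => f ω * Y ω) P := fun f => by
    obtain ⟨C, hC⟩ := f.exists_forall_norm_le
    exact hY.bdd_mul f.aestronglyMeasurable (Eventually.of_forall hC)
  induction f using SimpleFunc.induction with
  | const c hs =>
    rename_i s
    have h1 : ((SimpleFunc.memLp_of_isFiniteMeasure (SimpleFunc.piecewise s hs
        (SimpleFunc.const Ω c) (SimpleFunc.const Ω 0)) p P).toLp _) =
        c • indicatorConstLp p hs (measure_ne_top P _) (1 : ℝ) := by
      ext1
      grw [MemLp.coeFn_toLp, Lp.coeFn_smul, indicatorConstLp_coeFn]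
      refine Eventually.of_forall fun ω => ?_
      by_cases hω : ω ∈ s <;> simp [hω]
    rw [h1, map_smul, h, smul_eq_mul, ← integral_const_mul, ← integral_indicator hs]
    congr 1
    ext ω
    by_cases hω : ω ∈ s <;> simp [hω]
  | add hd hf hg =>
    rename_i f g
    have h1 : ((SimpleFunc.memLp_of_isFiniteMeasure (f + g) p P).toLp _) =
        (f.memLp_of_isFiniteMeasure p P).toLp f + (g.memLp_of_isFiniteMeasure p P).toLp g := by
      rw [← MemLp.toLp_add]
      rfl
    rw [h1, map_add, hf, hg, ← integral_add (hint f) (hint g)]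
    congr 1
    ext ω
    simp [add_mul]

/-- The density represents the functional at each `X` for which the product is integrable. -/
theorem apply_eq_integral_of_integrable (hp : p ≠ ∞) {φ : Lp ℝ p P →L[ℝ] ℝ} {Y : Ω → ℝ}
    (hY : Integrable Y P)
    (h : ∀ (A : Set Ω) (hA : MeasurableSet A),
      φ (indicatorConstLp p hA (measure_ne_top P _) (1 : ℝ)) = ∫ ω in A, Y ω ∂P)
    (X : Lp ℝ p P) (hXY : Integrable (fun ω => X ω * Y ω) P) :
    φ X = ∫ ω, X ω * Y ω ∂P := by
  have hXm : Measurable X := (Lp.stronglyMeasurable X).measurable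
  let s : ℕ → SimpleFunc Ω ℝ := fun k => SimpleFunc.approxOn X hXm Set.univ 0 (Set.mem_univ _) k
  have hs : ∀ k, MemLp (s k) p P := fun k => (s k).memLp_of_isFiniteMeasure p P
  have hlim1 : Tendsto (fun k => (hs k).toLp (s k)) atTop (𝓝 X) := by
    have := SimpleFunc.tendsto_approxOn_Lp_eLpNorm (p := p) hXm (Set.mem_univ (0 : ℝ)) hp
      (μ := P) (by simp) (by simpa using (Lp.memLp X).2)
    rw [Lp.tendsto_Lp_iff_tendsto_eLpNorm']
    refine this.congr fun k => eLpNorm_congr_ae ?_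
    filter_upwards [(hs k).coeFn_toLp] with ω h1
    simp [h1, s]
  have hlim2 : Tendsto (fun k => ∫ ω, s k ω * Y ω ∂P) atTop (𝓝 (∫ ω, X ω * Y ω ∂P)) := by
    -- The approximants based at `0` satisfy `‖s k ω‖ ≤ 2 * ‖X ω‖`, whence the factor 2.
    refine tendsto_integral_of_dominated_convergence (fun ω => 2 * ‖X ω * Y ω‖)
      (fun k => (s k).aestronglyMeasurable.mul hY.aestronglyMeasurable)
      (hXY.norm.const_mul 2) (fun k => Eventually.of_forall fun ω => ?_)
      (Eventually.of_forall fun ω => ?_)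
    · have := SimpleFunc.norm_approxOn_zero_le hXm (Set.mem_univ (0 : ℝ)) ω k
      rw [norm_mul, norm_mul, ← mul_assoc]
      gcongr
      linarith
    · exact (SimpleFunc.tendsto_approxOn hXm (Set.mem_univ (0 : ℝ)) (by simp)).mul_const _
  refine tendsto_nhds_unique ((φ.continuous.tendsto X).comp hlim1) (hlim2.congr fun k => ?_)
  exact (apply_toLp_simpleFunc_eq_integral hY h (s k)).symm

/-- Continuous linear functionals on `L_1` of a finite measure are given by bounded densities. -/
theorem exists_bounded_density_of_L1_dual (f : Lp ℝ 1 P →L[ℝ] ℝ) :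
    ∃ G : Lp ℝ 1 P, (∀ᵐ ω ∂P, ‖G ω‖ ≤ ‖f‖) ∧ ∀ Y : Lp ℝ 1 P, f Y = ∫ ω, G ω * Y ω ∂P := by
  obtain ⟨G, hG⟩ := exists_density_indicator ENNReal.one_ne_top f
  have hGi : Integrable G P := L1.integrable_coeFn G
  -- The indicator of `A` has `L_1` norm `P A`; such a bound on every `A` bounds `G` almost
  -- everywhere.
  have hb : ∀ (A : Set Ω), MeasurableSet A → |∫ ω in A, G ω ∂P| ≤ ‖f‖ * P.real A := by
    intro A hA
    rw [← hG A hA, ← Real.norm_eq_abs]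
    refine (f.le_opNorm _).trans ?_
    gcongr
    rw [norm_indicatorConstLp one_ne_zero ENNReal.one_ne_top]
    simp
  have hbd : ∀ᵐ ω ∂P, ‖G ω‖ ≤ ‖f‖ := by
    have h1 : G ≤ᵐ[P] fun _ => ‖f‖ := by
      refine ae_le_of_forall_setIntegral_le hGi (integrable_const _) fun A hA _ => ?_
      have := (abs_le.1 (hb A hA)).2
      simpa [mul_comm] using this
    have h2 : (fun _ => -‖f‖) ≤ᵐ[P] G := by
      refine ae_le_of_forall_setIntegral_le (integrable_const _) hGi fun A hA _ => ?_
      have := (abs_le.1 (hb A hA)).1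
      simpa [mul_comm] using this
    filter_upwards [h1, h2] with ω h3 h4
    exact abs_le.2 ⟨h4, h3⟩
  refine ⟨G, hbd, fun Y => ?_⟩
  have hYi : Integrable Y P := L1.integrable_coeFn Y
  rw [apply_eq_integral_of_integrable ENNReal.one_ne_top hGi hG Y
    (hYi.mul_bdd hGi.aestronglyMeasurable hbd)]
  simp only [mul_comm]

end Representation

/-! ### Coherent risk measures and the functionals they dominate. -/

section RiskMeasure

variable {Ω : Type*} {mΩ : MeasurableSpace Ω} {P : Measure Ω} {p q : ℝ≥0∞} {D : Set (Lp ℝ 1 P)}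

theorem IsRiskSet.memLp (hD : IsRiskSet P q D) {Y : Lp ℝ 1 P} (hY : Y ∈ D) : MemLp Y q P := by
  obtain ⟨C, hC⟩ := hD.bounded
  exact ⟨Lp.aestronglyMeasurable Y, (hC Y hY).trans_lt ENNReal.coe_lt_top⟩

theorem IsRiskSet.integrable_mul [p.HolderConjugate q] (hD : IsRiskSet P q D) (X : Lp ℝ p P)
    {Y : Lp ℝ 1 P} (hY : Y ∈ D) : Integrable (fun ω => X ω * Y ω) P :=
  (Lp.memLp X).integrable_mul (hD.memLp hY)

theorem IsRiskSet.expect_add [p.HolderConjugate q] (hD : IsRiskSet P q D) (X X' : Lp ℝ p P)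
    {Y : Lp ℝ 1 P} (hY : Y ∈ D) : expect (X + X') Y = expect X Y + expect X' Y := by
  unfold expect
  rw [← integral_add (hD.integrable_mul X hY) (hD.integrable_mul X' hY)]
  refine integral_congr_ae ?_
  filter_upwards [Lp.coeFn_add X X'] with ω h
  rw [h, Pi.add_apply, add_mul]

theorem expect_smul (c : ℝ) (X : Lp ℝ p P) (Y : Lp ℝ 1 P) :
    expect (c • X) Y = c * expect X Y := by
  unfold expect
  rw [← integral_const_mul]
  refine integral_congr_ae ?_
  filter_upwards [Lp.coeFn_smul c X] with ω h
  rw [h, Pi.smul_apply, smul_eq_mul, mul_assoc]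

theorem expect_zero (Y : Lp ℝ 1 P) : expect (0 : Lp ℝ p P) Y = 0 := by
  simpa using expect_smul 0 (0 : Lp ℝ p P) Y

theorem expect_neg (X : Lp ℝ p P) (Y : Lp ℝ 1 P) : expect (-X) Y = -expect X Y := by
  simpa using expect_smul (-1) X Y

theorem IsRiskSet.expect_sub [p.HolderConjugate q] (hD : IsRiskSet P q D) (X X' : Lp ℝ p P)
    {Y : Lp ℝ 1 P} (hY : Y ∈ D) : expect (X - X') Y = expect X Y - expect X' Y := by
  rw [sub_eq_add_neg, hD.expect_add X (-X') hY, expect_neg, sub_eq_add_neg]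

theorem IsRiskSet.expect_sum [p.HolderConjugate q] (hD : IsRiskSet P q D) {ι : Type*}
    (s : Finset ι) (X : ι → Lp ℝ p P) {Y : Lp ℝ 1 P} (hY : Y ∈ D) :
    expect (∑ i ∈ s, X i) Y = ∑ i ∈ s, expect (X i) Y := by
  classical
  induction s using Finset.induction_on with
  | empty => simp [expect_zero]
  | insert a s ha ih => rw [Finset.sum_insert ha, Finset.sum_insert ha, hD.expect_add _ _ hY, ih]

/-- Expectations over a risk set are bounded uniformly on the unit ball of `L_p`. -/
theorem IsRiskSet.exists_abs_expect_le [p.HolderConjugate q] (hD : IsRiskSet P q D) :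
    ∃ C : ℝ≥0, ∀ (X : Lp ℝ p P), ∀ Y ∈ D, |expect X Y| ≤ C * ‖X‖ := by
  obtain ⟨C, hC⟩ := hD.bounded
  refine ⟨C, fun X Y hY => ?_⟩
  have h1 : ‖∫ ω, X ω * Y ω ∂P‖ₑ ≤ eLpNorm X p P * C := by
    calc ‖∫ ω, X ω * Y ω ∂P‖ₑ ≤ ∫⁻ ω, ‖X ω * Y ω‖ₑ ∂P := enorm_integral_le_lintegral_enorm _
      _ = eLpNorm ((X : Ω → ℝ) • (Y : Ω → ℝ)) 1 P := by
        rw [eLpNorm_one_eq_lintegral_enorm]; rfl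
      _ ≤ eLpNorm X p P * eLpNorm Y q P :=
        eLpNorm_smul_le_mul_eLpNorm (Lp.aestronglyMeasurable Y) (Lp.aestronglyMeasurable X)
      _ ≤ _ := by gcongr; exact hC Y hY
  have h2 := ENNReal.toReal_mono (by finiteness [Lp.eLpNorm_ne_top X]) h1
  rw [ENNReal.toReal_mul, toReal_enorm] at h2
  rw [mul_comm, Lp.norm_def]
  exact h2

theorem IsRiskSet.bddAbove_expect [p.HolderConjugate q] (hD : IsRiskSet P q D) (X : Lp ℝ p P) :
    BddAbove ((fun Y => expect X Y) '' D) := by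
  obtain ⟨C, hC⟩ := hD.exists_abs_expect_le (p := p)
  exact ⟨C * ‖X‖, by rintro _ ⟨Y, hY, rfl⟩; exact (le_abs_self _).trans (hC X Y hY)⟩

theorem IsRiskSet.expect_le_riskMeasure [p.HolderConjugate q] (hD : IsRiskSet P q D)
    (X : Lp ℝ p P) {Y : Lp ℝ 1 P} (hY : Y ∈ D) : expect X Y ≤ riskMeasure D X :=
  le_csSup (hD.bddAbove_expect X) ⟨Y, hY, rfl⟩

theorem riskMeasure_le (hne : D.Nonempty) {X : Lp ℝ p P} {c : ℝ} (h : ∀ Y ∈ D, expect X Y ≤ c) :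
    riskMeasure D X ≤ c :=
  csSup_le (hne.image _) (by rintro _ ⟨Y, hY, rfl⟩; exact h Y hY)

theorem IsRiskSet.riskMeasure_add_le [p.HolderConjugate q] (hD : IsRiskSet P q D)
    (hne : D.Nonempty) (X X' : Lp ℝ p P) :
    riskMeasure D (X + X') ≤ riskMeasure D X + riskMeasure D X' :=
  riskMeasure_le hne fun Y hY => by
    rw [hD.expect_add _ _ hY]
    exact add_le_add (hD.expect_le_riskMeasure X hY) (hD.expect_le_riskMeasure X' hY)

/-- No condition on `D` is needed: the real supremum of an empty or unbounded set is 0, which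
scaling respects. -/
theorem riskMeasure_smul {c : ℝ} (hc : 0 < c) (X : Lp ℝ p P) :
    riskMeasure D (c • X) = c * riskMeasure D X := by
  unfold riskMeasure
  have : (fun Y => expect (c • X) Y) '' D = c • ((fun Y => expect X Y) '' D) := by
    rw [← Set.image_smul, Set.image_image]
    simp [expect_smul]
  rw [this, Real.sSup_smul_of_nonneg hc.le, smul_eq_mul]

theorem riskMeasure_zero (hne : D.Nonempty) : riskMeasure D (0 : Lp ℝ p P) = 0 := by
  simp [riskMeasure, expect_zero, hne]

variable [Fact (1 ≤ p)] [IsFiniteMeasure P]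

/-- A linear functional dominated by a coherent risk measure is given by an element of its
risk set. -/
theorem IsRiskSet.exists_mem_of_le_riskMeasure [p.HolderConjugate q] (hp : p ≠ ∞)
    (hD : IsRiskSet P q D) (hne : D.Nonempty) (l : Lp ℝ p P →ₗ[ℝ] ℝ)
    (hl : ∀ X, l X ≤ riskMeasure D X) : ∃ Y ∈ D, ∀ X, l X = expect X Y := by
  obtain ⟨C, hC⟩ := hD.exists_abs_expect_le (p := p)
  have hle : ∀ X, l X ≤ C * ‖X‖ := fun X =>
    (hl X).trans (riskMeasure_le hne fun Y hY => (le_abs_self _).trans (hC X Y hY))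
  have hbound : ∀ X, ‖l X‖ ≤ C * ‖X‖ := fun X => by
    refine abs_le.2 ⟨?_, hle X⟩
    have := hle (-X)
    rw [map_neg, norm_neg] at this
    linarith
  let φ : Lp ℝ p P →L[ℝ] ℝ := l.mkContinuous C hbound
  obtain ⟨Y, hY⟩ := exists_density_indicator hp φ
  have hYi : Integrable Y P := L1.integrable_coeFn Y
  -- If `Y ∉ D`, a functional on `L_1` strictly separates them. Its density `G` is bounded, hence a
  -- legitimate risk in `L_p`, and `l G = f Y > u ≥ riskMeasure D G` contradicts domination.
  have hmem : Y ∈ D := by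
    by_contra hYD
    obtain ⟨f, u, hfu, huf⟩ := geometric_hahn_banach_closed_point hD.convex hD.isClosed hYD
    obtain ⟨G, hGb, hG⟩ := exists_bounded_density_of_L1_dual f
    have hGm : MemLp G p P := MemLp.of_bound (Lp.aestronglyMeasurable G) _ hGb
    have hGX : ∀ Y : Lp ℝ 1 P, expect (hGm.toLp G) Y = f Y := fun Y => by
      rw [hG]
      refine integral_congr_ae ?_
      filter_upwards [hGm.coeFn_toLp] with ω h
      rw [h]
    -- Boundedness of `G` is essential here: `Y` is not yet known to lie in `L_q`.
    have h1 : Integrable (fun ω => (hGm.toLp G) ω * Y ω) P := by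
      refine (hYi.bdd_mul (Lp.aestronglyMeasurable G) hGb).congr ?_
      filter_upwards [hGm.coeFn_toLp] with ω h
      rw [h]
    have h2 : l (hGm.toLp G) = f Y :=
      (apply_eq_integral_of_integrable hp hYi hY (hGm.toLp G) h1).trans (hGX Y)
    have h3 : riskMeasure D (hGm.toLp G) ≤ u :=
      riskMeasure_le hne fun Y' hY' => by
        rw [hGX]
        exact (hfu Y' hY').le
    linarith [hl (hGm.toLp G)]
  exact ⟨Y, hmem, fun X =>
    apply_eq_integral_of_integrable hp hYi hY X (hD.integrable_mul X hmem)⟩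

/-- The maximum that defines a coherent risk measure is attained. -/
theorem IsRiskSet.isGreatest_riskMeasure [p.HolderConjugate q] (hp : p ≠ ∞)
    (hD : IsRiskSet P q D) (hne : D.Nonempty) (X : Lp ℝ p P) :
    IsGreatest ((fun Y => expect X Y) '' D) (riskMeasure D X) := by
  obtain ⟨l, hlX, hl⟩ := exists_linear_le_sublinear (riskMeasure D (p := p))
    (fun c hc X => riskMeasure_smul hc X) (hD.riskMeasure_add_le hne) X
  obtain ⟨Y, hY, hlY⟩ := hD.exists_mem_of_le_riskMeasure hp hne l hl
  refine ⟨⟨Y, hY, ?_⟩, ?_⟩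
  · exact (hlY X).symm.trans hlX
  · rintro _ ⟨Y', hY', rfl⟩
    exact hD.expect_le_riskMeasure X hY'

end RiskMeasure

/-! ### Trades form a linear space. -/

section Trade

variable {Ω : Type*} {𝓖 mΩ : MeasurableSpace Ω} {P : Measure Ω} {p : ℝ≥0∞} {n : ℕ}

theorem IsTrade.zero : IsTrade 𝓖 (0 : Fin n → Lp ℝ p P) :=
  ⟨fun i => Submodule.zero_mem (lpMeas ℝ ℝ 𝓖 p P), by simp⟩

theorem IsTrade.add {W W' : Fin n → Lp ℝ p P} (h : IsTrade 𝓖 W)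
    (h' : IsTrade 𝓖 W') : IsTrade 𝓖 (W + W') :=
  ⟨fun i => Submodule.add_mem (lpMeas ℝ ℝ 𝓖 p P) (h.1 i) (h'.1 i), by
    simp [Finset.sum_add_distrib, h.2, h'.2]⟩

theorem IsTrade.smul {W : Fin n → Lp ℝ p P} (h : IsTrade 𝓖 W) (c : ℝ) :
    IsTrade 𝓖 (c • W) :=
  ⟨fun i => Submodule.smul_mem (lpMeas ℝ ℝ 𝓖 p P) c (h.1 i), by
    simp [← Finset.smul_sum, h.2]⟩

/-- One agent buying a `𝓖`-measurable risk from another is a trade. -/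
theorem isTrade_single_sub_single (i j : Fin n) {X : Lp ℝ p P}
    (hX : AEStronglyMeasurable[𝓖] X P) :
    IsTrade 𝓖 (Pi.single i X - Pi.single j X : Fin n → Lp ℝ p P) := by
  have hs : ∀ i k, (Pi.single i X : Fin n → Lp ℝ p P) k ∈ lpMeas ℝ ℝ 𝓖 p P := fun i k => by
    by_cases hk : k = i
    · subst hk
      simpa [mem_lpMeas_iff_aestronglyMeasurable] using hX
    · simp [hk]
  exact ⟨fun k => Submodule.sub_mem (lpMeas ℝ ℝ 𝓖 p P) (hs i k) (hs j k), by
    simp [Finset.sum_sub_distrib]⟩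

end Trade

/-! ### Duality between trades and prices. -/

section Market

variable {Ω : Type*} {mΩ : MeasurableSpace Ω} {P : Measure Ω} {p q : ℝ≥0∞} {n : ℕ}
  {D : Fin n → Set (Lp ℝ 1 P)}

theorem totalExpect_sub [p.HolderConjugate q] (hD : ∀ i, IsRiskSet P q (D i))
    (X X' : Fin n → Lp ℝ p P) {Y : Fin n → Lp ℝ 1 P} (hY : ∀ i, Y i ∈ D i) :
    totalExpect (X - X') Y = totalExpect X Y - totalExpect X' Y := by
  simp only [totalExpect, Pi.sub_apply, ← Finset.sum_sub_distrib]
  exact Finset.sum_congr rfl fun i _ => (hD i).expect_sub _ _ (hY i)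

theorem totalExpect_le_socialRisk [p.HolderConjugate q] (hD : ∀ i, IsRiskSet P q (D i))
    (Z W : Fin n → Lp ℝ p P) {Y : Fin n → Lp ℝ 1 P} (hY : ∀ i, Y i ∈ D i) :
    totalExpect (Z - W) Y ≤ socialRisk D Z W :=
  Finset.sum_le_sum fun i _ => (hD i).expect_le_riskMeasure _ (hY i)

theorem isGreatest_socialRisk [p.HolderConjugate q] [Fact (1 ≤ p)] [IsFiniteMeasure P]
    (hp : p ≠ ∞) (hD : ∀ i, IsRiskSet P q (D i)) (hne : ∀ i, (D i).Nonempty)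
    (Z W : Fin n → Lp ℝ p P) :
    IsGreatest ((fun Y => totalExpect (Z - W) Y) '' {Y | ∀ i, Y i ∈ D i})
      (socialRisk D Z W) := by
  constructor
  · choose Y hY hYe using fun i => ((hD i).isGreatest_riskMeasure hp (hne i) (Z i - W i)).1
    exact ⟨Y, hY, Finset.sum_congr rfl fun i _ => hYe i⟩
  · rintro _ ⟨Y, hY, rfl⟩
    exact totalExpect_le_socialRisk hD Z W hY

/-- Trades have no value under feasible prices. -/
theorem IsTrade.totalExpect_eq_zero [IsFiniteMeasure P] [p.HolderConjugate q]
    (hD : ∀ i, IsRiskSet P q (D i)) {𝓖 : MeasurableSpace Ω} (h𝓖 : 𝓖 ≤ mΩ)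
    {W : Fin n → Lp ℝ p P} (hW : IsTrade 𝓖 W) {Y : Fin n → Lp ℝ 1 P}
    (hY : IsPriceFeasible 𝓖 D Y) : totalExpect W Y = 0 := by
  rcases n.eq_zero_or_pos with rfl | hn
  · simp [totalExpect]
  let j : Fin n := ⟨0, hn⟩
  have hint : ∀ i, Integrable ((W i : Ω → ℝ) * (Y i : Ω → ℝ)) P := fun i =>
    (hD i).integrable_mul (W i) (hY.1 i)
  -- `W i` is pulled out of the conditional expectation, and the common value `P[Y j | 𝓖]` then
  -- factors out of `∑ i, W i = 0`.
  have hpull : ∀ i, P[(W i : Ω → ℝ) * (Y i : Ω → ℝ) | 𝓖] =ᵐ[P]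
      fun ω => W i ω * (P[Y j | 𝓖]) ω := fun i => by
    filter_upwards [condExp_mul_of_aestronglyMeasurable_left (hW.1 i) (hint i)
      (L1.integrable_coeFn (Y i)), hY.2 i j] with ω h1 h2
    rw [h1, Pi.mul_apply, h2]
  have hexp : ∀ i, expect (W i) (Y i) = ∫ ω, W i ω * (P[Y j | 𝓖]) ω ∂P := fun i => by
    rw [← integral_congr_ae (hpull i), integral_condExp h𝓖]
    rfl
  unfold totalExpect
  simp only [hexp]
  rw [← integral_finsetSum _ fun i _ => integrable_condExp.congr (hpull i)]
  refine integral_eq_zero_of_ae ?_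
  have hsum : ∀ᵐ ω ∂P, ∑ i, W i ω = 0 := by
    have h1 := Lp.coeFn_finsetSum Finset.univ W
    rw [hW.2] at h1
    filter_upwards [h1, Lp.coeFn_zero ℝ p P] with ω h2 h3
    rw [h3] at h2
    simpa using h2.symm
  filter_upwards [hsum] with ω h
  simp [← Finset.sum_mul, h]

/-- Prices under which no trade has positive value are feasible. -/
theorem isPriceFeasible_of_totalExpect_nonpos [IsFiniteMeasure P] {𝓖 : MeasurableSpace Ω}
    (h𝓖 : 𝓖 ≤ mΩ) {Y : Fin n → Lp ℝ 1 P} (hY : ∀ i, Y i ∈ D i)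
    (h : ∀ W : Fin n → Lp ℝ p P, IsTrade 𝓖 W → totalExpect W Y ≤ 0) :
    IsPriceFeasible 𝓖 D Y := by
  classical
  -- Test with the trade that moves the indicator of `A` between `j` and `i`; exchanging the roles
  -- gives equality.
  have hle : ∀ i j, i ≠ j → ∀ A, MeasurableSet[𝓖] A →
      ∫ ω in A, Y i ω ∂P ≤ ∫ ω in A, Y j ω ∂P := by
    intro i j hij A hA
    let X : Lp ℝ p P := indicatorConstLp p (h𝓖 A hA) (measure_ne_top P _) (1 : ℝ)
    have hX : AEStronglyMeasurable[𝓖] X P :=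
      ⟨A.indicator fun _ => 1, stronglyMeasurable_const.indicator hA, indicatorConstLp_coeFn⟩
    have hXe : ∀ Y : Lp ℝ 1 P, expect X Y = ∫ ω in A, Y ω ∂P := fun Y => by
      rw [← integral_indicator (h𝓖 A hA)]
      refine integral_congr_ae ?_
      filter_upwards [indicatorConstLp_coeFn (p := p) (hs := h𝓖 A hA)
        (hμs := measure_ne_top P _) (c := (1 : ℝ))] with ω hω
      rw [hω]
      by_cases hωA : ω ∈ A <;> simp [hωA]
    have h1 := h _ (isTrade_single_sub_single i j hX)
    have h2 : totalExpect (Pi.single i X - Pi.single j X : Fin n → Lp ℝ p P) Y =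
        expect X (Y i) - expect X (Y j) := by
      unfold totalExpect
      rw [← Finset.add_sum_erase _ _ (Finset.mem_univ i),
        ← Finset.add_sum_erase _ _ (Finset.mem_erase.2 ⟨hij.symm, Finset.mem_univ j⟩),
        Finset.sum_eq_zero]
      · simp [hij, hij.symm, expect_neg, sub_eq_add_neg]
      · intro k hk
        simp only [Finset.mem_erase] at hk
        simp [hk.1, hk.2.1, expect_zero]
    rw [h2, hXe, hXe] at h1
    linarith
  refine ⟨hY, fun i j => ?_⟩
  by_cases hij : i = j
  · subst hij; rfl
  refine ae_eq_condExp_of_forall_setIntegral_eq h𝓖 (L1.integrable_coeFn (Y j))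
    (fun A _ _ => integrable_condExp.integrableOn) (fun A hA _ => ?_)
    stronglyMeasurable_condExp.aestronglyMeasurable
  rw [setIntegral_condExp h𝓖 (L1.integrable_coeFn (Y i)) hA]
  exact le_antisymm (hle i j hij A hA) (hle j i (Ne.symm hij) A hA)

/-- A linear functional dominated by the total risk is given by a tuple of prices of risk. -/
theorem exists_mem_of_le_sum_riskMeasure [p.HolderConjugate q] [Fact (1 ≤ p)] [IsFiniteMeasure P]
    (hp : p ≠ ∞) (hD : ∀ i, IsRiskSet P q (D i)) (hne : ∀ i, (D i).Nonempty)
    (l : (Fin n → Lp ℝ p P) →ₗ[ℝ] ℝ) (hl : ∀ V, l V ≤ ∑ i, riskMeasure (D i) (V i)) :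
    ∃ Y : Fin n → Lp ℝ 1 P, (∀ i, Y i ∈ D i) ∧ ∀ V, l V = totalExpect V Y := by
  classical
  have hsingle : ∀ i, ∃ Y ∈ D i, ∀ X, (l.comp (LinearMap.single ℝ (fun _ => Lp ℝ p P) i)) X =
      expect X Y := fun i => by
    refine (hD i).exists_mem_of_le_riskMeasure hp (hne i) _ fun X => (hl _).trans_eq ?_
    rw [Finset.sum_eq_single i]
    · simp
    · intro j _ hj
      simp [hj, riskMeasure_zero (hne j)]
    · simp
  choose Y hY hlY using hsingle
  refine ⟨Y, hY, fun V => ?_⟩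
  rw [← LinearMap.sum_single_apply (fun _ => Lp ℝ p P) V, map_sum]
  simp only [LinearMap.sum_single_apply]
  exact Finset.sum_congr rfl fun i _ => hlY i (V i)

/-- Strong duality: some feasible prices of risk attain the infimum of the total risk. -/
theorem exists_isPriceFeasible_isGLB [p.HolderConjugate q] [Fact (1 ≤ p)] [IsFiniteMeasure P]
    (hp : p ≠ ∞) (hD : ∀ i, IsRiskSet P q (D i)) (hD_inter : (⋂ i, D i).Nonempty)
    {𝓖 : MeasurableSpace Ω} (h𝓖 : 𝓖 ≤ mΩ) (Z : Fin n → Lp ℝ p P) :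
    ∃ Y, IsPriceFeasible 𝓖 D Y ∧
      IsGLB (socialRisk D Z '' {W | IsTrade 𝓖 W}) (totalExpect Z Y) := by
  obtain ⟨Y₀, hY₀⟩ := hD_inter
  have hY₀' : ∀ i, Y₀ ∈ D i := Set.mem_iInter.1 hY₀
  have hne : ∀ i, (D i).Nonempty := fun i => ⟨Y₀, hY₀' i⟩
  have hfeas : IsPriceFeasible 𝓖 D fun _ => Y₀ := ⟨hY₀', fun _ _ => Filter.EventuallyEq.rfl⟩
  let S : (Fin n → Lp ℝ p P) → Set ℝ := fun V => socialRisk D V '' {W | IsTrade 𝓖 W}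
  have hSne : ∀ V, (S V).Nonempty := fun V => ⟨_, 0, IsTrade.zero, rfl⟩
  -- Weak duality at the constant tuple `Y₀`; this is where the `D i` must have a common element.
  have hSbdd : ∀ V, BddBelow (S V) := fun V => ⟨totalExpect V fun _ => Y₀, by
    rintro _ ⟨W, hW, rfl⟩
    have := totalExpect_le_socialRisk hD V W hY₀'
    rwa [totalExpect_sub hD V W hY₀', hW.totalExpect_eq_zero hD h𝓖 hfeas, sub_zero] at this⟩
  obtain ⟨l, hlZ, hl⟩ := exists_linear_le_sublinear (fun V => sInf (S V))
    (fun c hc V => by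
      have : S (c • V) = c • S V := by
        have hsr : ∀ W, socialRisk D (c • V) (c • W) = c • socialRisk D V W := fun W => by
          simp only [socialRisk, Pi.smul_apply, ← smul_sub, riskMeasure_smul hc, smul_eq_mul,
            Finset.mul_sum]
        ext x
        simp only [S, Set.mem_smul_set, Set.exists_mem_image, ← hsr]
        constructor
        · rintro ⟨W, hW, rfl⟩
          exact ⟨c⁻¹ • W, hW.smul _, by rw [smul_inv_smul₀ hc.ne']⟩
        · rintro ⟨W, hW, rfl⟩
          exact ⟨c • W, hW.smul _, rfl⟩
      rw [this, Real.sInf_smul_of_nonneg hc.le, smul_eq_mul])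
    (fun V V' => by
      rw [← csInf_add (hSne V) (hSbdd V) (hSne V') (hSbdd V')]
      refine le_csInf ((hSne V).add (hSne V')) ?_
      rintro _ ⟨_, ⟨W, hW, rfl⟩, _, ⟨W', hW', rfl⟩, rfl⟩
      refine (csInf_le (hSbdd _) ⟨W + W', hW.add hW', rfl⟩).trans ?_
      simp only [socialRisk, ← Finset.sum_add_distrib]
      refine Finset.sum_le_sum fun i _ => ?_
      rw [Pi.add_apply, Pi.add_apply, add_sub_add_comm]
      exact (hD i).riskMeasure_add_le (hne i) _ _) Z
  obtain ⟨Y, hY, hlY⟩ := exists_mem_of_le_sum_riskMeasure hp hD hne l fun V =>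
    (hl V).trans ((csInf_le (hSbdd V) ⟨0, IsTrade.zero, rfl⟩).trans_eq (by simp [socialRisk]))
  -- A trade `W` is cancelled by itself, so the infimum at `V = W` is at most `∑ r_i(0) = 0`.
  refine ⟨Y, isPriceFeasible_of_totalExpect_nonpos (p := p) h𝓖 hY fun W hW => ?_, ?_⟩
  · rw [← hlY]
    refine (hl W).trans ((csInf_le (hSbdd W) ⟨W, hW, rfl⟩).trans_eq ?_)
    simp [socialRisk, riskMeasure_zero (hne _)]
  · rw [← hlY, hlZ]
    exact isGLB_csInf (hSne Z) (hSbdd Z)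

theorem IsPriceFeasible.totalExpect_le_socialRisk [p.HolderConjugate q] [IsFiniteMeasure P]
    (hD : ∀ i, IsRiskSet P q (D i)) {𝓖 : MeasurableSpace Ω} (h𝓖 : 𝓖 ≤ mΩ)
    {Y : Fin n → Lp ℝ 1 P} (hY : IsPriceFeasible 𝓖 D Y) (Z : Fin n → Lp ℝ p P)
    {W : Fin n → Lp ℝ p P} (hW : IsTrade 𝓖 W) : totalExpect Z Y ≤ socialRisk D Z W := by
  have := RiskMarket.totalExpect_le_socialRisk hD Z W hY.1
  rwa [totalExpect_sub hD Z W hY.1, hW.totalExpect_eq_zero hD h𝓖 hY, sub_zero] at this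

/-- By weak duality every feasible value is a lower bound for the social risks, so it cannot exceed
the attained infimum. No optimal trade need exist. -/
theorem exists_isPriceOptimum [p.HolderConjugate q] [Fact (1 ≤ p)] [IsFiniteMeasure P]
    (hp : p ≠ ∞) (hD : ∀ i, IsRiskSet P q (D i)) (hD_inter : (⋂ i, D i).Nonempty)
    {𝓖 : MeasurableSpace Ω} (h𝓖 : 𝓖 ≤ mΩ) (Z : Fin n → Lp ℝ p P) :
    ∃ Y, IsPriceOptimum 𝓖 D Z Y := by
  obtain ⟨Y, hY, hglb⟩ := exists_isPriceFeasible_isGLB hp hD hD_inter h𝓖 Z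
  refine ⟨Y, hY, fun Y' hY' => hglb.2 ?_⟩
  rintro _ ⟨W, hW, rfl⟩
  exact hY'.totalExpect_le_socialRisk hD h𝓖 Z hW

/-- Complementary slackness: the social risk at `W` bounds every inner value, equals the optimal
price value, and `W` costs nothing under `Y`. -/
theorem IsPriceOptimum.isInnerOptimum [p.HolderConjugate q] [Fact (1 ≤ p)] [IsFiniteMeasure P]
    (hp : p ≠ ∞) (hD : ∀ i, IsRiskSet P q (D i)) (hD_inter : (⋂ i, D i).Nonempty)
    {𝓖 : MeasurableSpace Ω} (h𝓖 : 𝓖 ≤ mΩ) {Z W : Fin n → Lp ℝ p P} {Y : Fin n → Lp ℝ 1 P}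
    (hY : IsPriceOptimum 𝓖 D Z Y) (hW : IsOptimalTrade 𝓖 D Z W) : IsInnerOptimum D Z W Y := by
  obtain ⟨Y₁, hY₁, hglb⟩ := exists_isPriceFeasible_isGLB hp hD hD_inter h𝓖 Z
  refine ⟨hY.1.1, fun Y' hY' => ?_⟩
  calc totalExpect (Z - W) Y' ≤ socialRisk D Z W := totalExpect_le_socialRisk hD Z W hY'
    _ ≤ totalExpect Z Y₁ := hglb.2 (by rintro _ ⟨W', hW', rfl⟩; exact hW.2 W' hW')
    _ ≤ totalExpect Z Y := hY.2 Y₁ hY₁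
    _ = totalExpect (Z - W) Y := by
      rw [totalExpect_sub hD Z W hY.1.1, hW.1.totalExpect_eq_zero hD h𝓖 hY.1, sub_zero]

/-- Conditioning on the full σ-field changes nothing, so the `Y i` themselves must coincide. -/
theorem isPriceFeasible_top_iff [IsFiniteMeasure P] (hn : 0 < n) {Y : Fin n → Lp ℝ 1 P} :
    IsPriceFeasible mΩ D Y ↔ ∃ Y₀ ∈ ⋂ i, D i, Y = fun _ => Y₀ := by
  constructor
  · rintro ⟨hY, hc⟩
    have hself : ∀ i, P[Y i | mΩ] =ᵐ[P] Y i := fun i =>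
      condExp_of_aestronglyMeasurable' le_rfl (Lp.aestronglyMeasurable (Y i))
        (L1.integrable_coeFn (Y i))
    have heq : ∀ i j, Y i = Y j := fun i j =>
      Lp.ext ((hself i).symm.trans ((hc i j).trans (hself j)))
    exact ⟨Y ⟨0, hn⟩, Set.mem_iInter.2 fun i => heq i ⟨0, hn⟩ ▸ hY i, funext fun i => heq i _⟩
  · rintro ⟨Y₀, hY₀, rfl⟩
    exact ⟨Set.mem_iInter.1 hY₀, fun _ _ => Filter.EventuallyEq.rfl⟩

theorem isPriceOptimum_top_iff [p.HolderConjugate q] [IsFiniteMeasure P] (hn : 0 < n)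
    (hD : ∀ i, IsRiskSet P q (D i)) {Z : Fin n → Lp ℝ p P} {Y : Fin n → Lp ℝ 1 P} :
    IsPriceOptimum mΩ D Z Y ↔ ∃ Y₀, IsCompletePriceOptimum D Z Y₀ ∧ Y = fun _ => Y₀ := by
  have hval : ∀ Y₀ ∈ ⋂ i, D i, totalExpect Z (fun _ => Y₀) = expect (∑ i, Z i) Y₀ :=
    fun Y₀ hY₀ =>
      ((hD ⟨0, hn⟩).expect_sum Finset.univ Z (Set.mem_iInter.1 hY₀ ⟨0, hn⟩)).symm
  constructor
  · rintro ⟨hY, hmax⟩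
    obtain ⟨Y₀, hY₀, rfl⟩ := (isPriceFeasible_top_iff hn).1 hY
    refine ⟨Y₀, ⟨hY₀, fun Y' hY' => ?_⟩, rfl⟩
    rw [← hval Y' hY', ← hval Y₀ hY₀]
    exact hmax _ ((isPriceFeasible_top_iff hn).2 ⟨Y', hY', rfl⟩)
  · rintro ⟨Y₀, ⟨hY₀, hmax⟩, rfl⟩
    refine ⟨(isPriceFeasible_top_iff hn).2 ⟨Y₀, hY₀, rfl⟩, fun Y' hY' => ?_⟩
    obtain ⟨Y₁, hY₁, rfl⟩ := (isPriceFeasible_top_iff hn).1 hY'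
    rw [hval Y₁ hY₁, hval Y₀ hY₀]
    exact hmax Y₁ hY₁

end Market

end RiskMarket

theorem mainTheorem2 {Ω : Type*} [mΩ : MeasurableSpace Ω] (P : Measure Ω) [IsProbabilityMeasure P]
    (p q : ℝ≥0∞) (hp : 1 ≤ p) (hp_top : p ≠ ∞) (hpq : p⁻¹ + q⁻¹ = 1)
    (n : ℕ) (hn : 2 ≤ n)
    (D : Fin n → Set (Lp ℝ 1 P)) (hD : ∀ i, RiskMarket.IsRiskSet P q (D i))
    (hD_inter : (⋂ i, D i).Nonempty)
    (Z : Fin n → Lp ℝ p P) :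
    -- the maxima defining the risk measures are attained
    (∀ (i : Fin n) (X : Lp ℝ p P),
      IsGreatest ((fun Y => RiskMarket.expect X Y) '' D i) (RiskMarket.riskMeasure (D i) X)) ∧
    -- the total risk is the value of the inner maximization over all price tuples
    (∀ W : Fin n → Lp ℝ p P,
      IsGreatest ((fun Y => RiskMarket.totalExpect (Z - W) Y) '' {Y | ∀ i, Y i ∈ D i})
        (RiskMarket.socialRisk D Z W)) ∧
    -- any market given by a sub-σ-field
    (∀ 𝓖 : MeasurableSpace Ω, 𝓖 ≤ mΩ →
      (∃ Y, RiskMarket.IsPriceOptimum 𝓖 D Z Y) ∧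
      ∀ W, RiskMarket.IsOptimalTrade 𝓖 D Z W →
        ∀ Y, RiskMarket.IsPriceOptimum 𝓖 D Z Y → RiskMarket.IsInnerOptimum D Z W Y) ∧
    -- the complete market
    (∀ Y, RiskMarket.IsPriceOptimum mΩ D Z Y ↔
      ∃ Y₀, RiskMarket.IsCompletePriceOptimum D Z Y₀ ∧ Y = fun _ => Y₀) ∧
    (∀ W, RiskMarket.IsOptimalTrade mΩ D Z W →
      ∀ Y₀, RiskMarket.IsCompletePriceOptimum D Z Y₀ →
        RiskMarket.IsInnerOptimum D Z W (fun _ => Y₀)) := by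
  have : Fact (1 ≤ p) := ⟨hp⟩
  have : p.HolderConjugate q := ENNReal.holderConjugate_iff.2 hpq
  have hn0 : 0 < n := by omega
  have hne : ∀ i, (D i).Nonempty := fun i => hD_inter.mono (Set.iInter_subset D i)
  refine ⟨fun i X => (hD i).isGreatest_riskMeasure hp_top (hne i) X,
    fun W => RiskMarket.isGreatest_socialRisk hp_top hD hne Z W,
    fun 𝓖 h𝓖 => ⟨RiskMarket.exists_isPriceOptimum hp_top hD hD_inter h𝓖 Z,
      fun W hW Y hY => hY.isInnerOptimum hp_top hD hD_inter h𝓖 hW⟩,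
    fun Y => RiskMarket.isPriceOptimum_top_iff hn0 hD, fun W hW Y₀ hY₀ => ?_⟩
  exact ((RiskMarket.isPriceOptimum_top_iff hn0 hD).2 ⟨Y₀, hY₀, rfl⟩).isInnerOptimum hp_top hD
    hD_inter le_rfl hW
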